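/- For $n\ge 2$ let $\mathfrak{P}_n$ be the pipeline elementary Petri net $$t_1\to p_1\to t_2\to p_2\to\cdots\to p_{n-1}\to t_n,$$ that is, the net with places $p_1,\dots,p_{n-1}$ and events $t_1,\dots,t_n$, where $\mathrm{pre}(t_1)=\emptyset$, $\mathrm{pre}(t_i)=\{p_{i-1}\}$ for $2\le i\le n$, $\mathrm{post}(t_i)=\{p_i\}$ for $1\le i\le n-1$, and $\mathrm{post}(t_n)=\emptyset$, with an arbitrary initial state $s_0\subseteq\{p_1,\dots,p_{n-1}\}$. A state is a set $s$ of places. For an event $a$ with $\mathrm{pre}(a)\subseteq s$ and $(s\setminus\mathrm{pre}(a))\cap\mathrm{post}(a)=\emptyset$ one puts $s\cdot a=(s\setminus\mathrm{pre}(a))\cup\mathrm{post}(a)$; otherwise $s\cdot a$ is undefined. This extends to a partial right action on states of the trace monoid $M(E,I)$, which is generated by the set $E$ of events with relations $ab=ba$ whenever $(\mathrm{pre}(a)\cup\mathrm{post}(a))\cap(\mathrm{pre}(b)\cup\mathrm{post}(b))=\emptyset$. Let $K$ be the category whose objects are the states reachable from $s_0$ (those of the form $s_0\cdot\mu$ with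 $\mu\in M(E,I)$), whose morphisms $s\to t$ are the $\mu\in M(E,I)$ with $s\cdot\mu=t$, and whose composition is multiplication in $M(E,I)$. Let $H_k(\mathfrak{P}_n)$ be the $k$-th integral homology group of the nerve of $K$. Then $$H_0(\mathfrak{P}_n)\cong H_1(\mathfrak{P}_n)\cong\mathbb{Z},\qquad H_k(\mathfrak{P}_n)=0\ \text{ for all } k>1 .$$ -/

import Mathlib

open CategoryTheory

/-- A partial map `S ⇀ S`; `f.app s = none` means that `f` is undefined at `s`. -/
@[ext]
structure PartialSelfMap (S : Type) : Type where
  app : S → Option S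

namespace PartialSelfMap

/-- Partial maps `S ⇀ S` form a monoid, `f * g` being "first `f`, then `g`".  This is the opposite
of the endomorphism monoid of `S` in the category of sets and partial maps (where the product is
composition), so that a partial *right* action of a monoid `M` on `S` is a monoid homomorphism
`M →* PartialSelfMap S`. -/
instance instMonoid (S : Type) : Monoid (PartialSelfMap S) where
  one := ⟨fun s => some s⟩
  mul f g := ⟨fun s => (f.app s).bind g.app⟩
  one_mul _ := rfl
  mul_one f := PartialSelfMap.ext (funext fun s => Option.bind_fun_some (f.app s))
  mul_assoc f g h := PartialSelfMap.ext (funext fun s => Option.bind_assoc (f.app s) g.app h.app)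

theorem one_app {S : Type} (s : S) : (1 : PartialSelfMap S).app s = some s := rfl

theorem mul_app {S : Type} (f g : PartialSelfMap S) (s : S) :
    (f * g).app s = (f.app s).bind g.app := rfl

end PartialSelfMap

/-- The trace monoid (free partially commutative monoid) `M(E, I)`: generated by `E`, with the
relations `a b = b a` for `(a, b) ∈ I`. -/
abbrev TraceMonoid (E : Type) (I : E → E → Prop) : Type :=
  PresentedMonoid (fun x y : FreeMonoid E => ∃ a b : E, I a b ∧
    x = FreeMonoid.of a * FreeMonoid.of b ∧ y = FreeMonoid.of b * FreeMonoid.of a)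

/-- The state category `K(S)` of a partial right action `act` of a monoid `M` on `S`: its objects
are the elements of `S`. -/
structure StateCategory {M S : Type} [Monoid M] (act : M →* PartialSelfMap S) : Type where
  state : S

namespace StateCategory

variable {M S : Type} [Monoid M] {act : M →* PartialSelfMap S}

/-- A morphism `s ⟶ t` is an element `μ` of the monoid such that `s · μ` is defined and equals `t`.
The composite of `μ : s ⟶ t` and `ν : t ⟶ u` is `μ ν : s ⟶ u`. -/
instance instCategory : Category.{0} (StateCategory act) where
  Hom s t := { μ : M // (act μ).app s.state = some t.state }
  id s := ⟨1, by rw [map_one]; rfl⟩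
  comp {s t u} f g := ⟨f.1 * g.1, by
    rw [map_mul, PartialSelfMap.mul_app, f.2]
    exact g.2⟩
  id_comp f := Subtype.ext (one_mul f.1)
  comp_id f := Subtype.ext (mul_one f.1)
  assoc f g h := Subtype.ext (mul_assoc f.1 g.1 h.1)

end StateCategory

/-- An elementary Petri net: places `P`, events `E`, the sets of places `pre a` and `post a` for
each event `a`, and an initial state `init`.  A state is a set of places. -/
structure ElementaryNet : Type 1 where
  P : Type
  E : Type
  pre : E → Set P
  post : E → Set P
  init : Set P

namespace ElementaryNet

variable (N : ElementaryNet)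

/-- Independence of events: they share no place. -/
def Indep (a b : N.E) : Prop :=
  (N.pre a ∪ N.post a) ∩ (N.pre b ∪ N.post b) = ∅

/-- The event `a` is enabled in the state `s`. -/
def Enabled (s : Set N.P) (a : N.E) : Prop :=
  N.pre a ⊆ s ∧ (s \ N.pre a) ∩ N.post a = ∅

open Classical in
/-- The partial map `s ↦ s · a = (s \ pre a) ∪ post a`, defined where `a` is enabled. -/
noncomputable def step (a : N.E) : PartialSelfMap (Set N.P) := ⟨fun s =>
  if N.Enabled s a then some ((s \ N.pre a) ∪ N.post a) else none⟩

theorem step_eq_some_iff (a : N.E) (s t : Set N.P) :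
    (N.step a).app s = some t ↔ N.Enabled s a ∧ (s \ N.pre a) ∪ N.post a = t := by
  simp only [step]
  split_ifs with h <;> simp [h]

theorem step_mul_eq_some {a b : N.E} (h : N.Indep a b) {s t : Set N.P}
    (hs : (N.step a * N.step b).app s = some t) : (N.step b * N.step a).app s = some t := by
  rw [PartialSelfMap.mul_app, Option.bind_eq_some_iff] at hs ⊢
  obtain ⟨u, hu, ht⟩ := hs
  rw [step_eq_some_iff] at hu ht
  obtain ⟨⟨h1, h2⟩, rfl⟩ := hu
  obtain ⟨⟨h3, h4⟩, rfl⟩ := ht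
  refine ⟨(s \ N.pre b) ∪ N.post b, ?_, ?_⟩ <;> rw [step_eq_some_iff] <;>
    simp only [Indep, Enabled, Set.ext_iff, Set.subset_def, Set.mem_inter_iff, Set.mem_union,
      Set.mem_sdiff, Set.mem_empty_iff_false, iff_false] at * <;> grind

/-- Independent events commute as partial maps of states. -/
theorem step_mul_comm {a b : N.E} (h : N.Indep a b) :
    N.step a * N.step b = N.step b * N.step a := by
  have h' : N.Indep b a := by
    unfold Indep at h ⊢
    rwa [Set.inter_comm]
  ext s t
  exact ⟨N.step_mul_eq_some h, N.step_mul_eq_some h'⟩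

/-- The partial right action of the trace monoid `M(E, I)` on the set of all states, extending
`s ↦ s · a`. -/
noncomputable def action : TraceMonoid N.E N.Indep →* PartialSelfMap (Set N.P) :=
  PresentedMonoid.lift N.step (by
    rintro _ _ ⟨a, b, hab, rfl, rfl⟩
    simpa using N.step_mul_comm hab)

/-- The reachable states: those of the form `init · μ`. -/
def Reachable : ObjectProperty (StateCategory N.action) := fun s =>
  ∃ μ : TraceMonoid N.E N.Indep, (N.action μ).app N.init = some s.state

/-- The category of reachable states, a full subcategory of the state category. -/
abbrev ReachableCategory : Type := N.Reachable.FullSubcategory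

/-- The integral homology group `H_k(N)`: the homology with coefficients in `ℤ` of the nerve of
the category of reachable states. -/
noncomputable def homology (k : ℕ) : AddCommGrpCat.{0} :=
  (nerve N.ReachableCategory).homology (AddCommGrpCat.of ℤ) k

end ElementaryNet

/-- The pipeline net `t₁ → p₁ → t₂ → p₂ → ⋯ → p_{n-1} → t_n` with initial state `s₀`.  With indices
counted from zero, the event `i : Fin n` is `t_{i+1}` and the place `p : Fin (n - 1)` is `p_{p+1}`;
so `i` consumes from the place `i - 1` (if there is one) and produces into the place `i` (if there
is one). -/
abbrev pipeline (n : ℕ) (s₀ : Set (Fin (n - 1))) : ElementaryNet where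
  P := Fin (n - 1)
  E := Fin n
  pre i := { p | (p : ℕ) + 1 = (i : ℕ) }
  post i := { p | (p : ℕ) = (i : ℕ) }
  init := s₀

/-!
Firing the events of a pipeline, the occurrences of `t_i` and `t_{i+1}` alternate, because the place
between them holds at most one token. Hence a trace that runs from `s` to `t` is determined by how
often the last event occurs in it: the other numbers of occurrences follow by conservation of tokens
(`Pipeline.count_conservation`), and a run of a conflict-free net is determined by its start and its
numbers of occurrences (`ElementaryNet.ConflictFree.eq_of_count_eq`). Let `o` be the empty state and
`g` the loop at `o` along which one token travels through the whole net. Each state `t` is reached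
from `o` by a trace `ε` without the last event, so that the morphisms `o ⟶ t` are exactly
`ε, g ε, g² ε, …`, without repetitions.

A category `C` with such an object `o` has the homology of a circle (`nerve.homology_of_free_hom`).
The under category of `o` has an initial object, so that its nerve `X` has the homology of a point.
Precomposition with `g` defines an endomorphism `T` of `X`, and the simplices of `X` over a simplex
`y` of the nerve `Y` of `C` are `y₀, T y₀, T² y₀, …`. This gives a short exact sequence of chain
complexes `0 ⟶ C(X) ⟶ C(X) ⟶ C(Y) ⟶ 0` with first map `1 - T`, split in each degree. The result is
read off from its long exact sequence, as `1 - T` vanishes on `H₀(X) = ℤ`.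
-/

/-! ### Homology of simplicial sets with a free shift -/

namespace SSet

open Limits Simplicial

section ChainComplex

variable {C : Type*} [Category C] [Preadditive C] [HasCoproducts.{0} C]

/-- A simplicial set with an operator `s` that behaves like an extra degeneracy towards the faces
(the cone operator of a contraction) has no homology in positive degrees: `s` is a contracting
chain homotopy there. -/
theorem isZero_homology_of_cone [CategoryWithHomology C]
    (X : SSet.{0}) (R : C) (s : ∀ n : ℕ, X _⦋n⦌ → X _⦋n + 1⦌)
    (h₀ : ∀ (n : ℕ) (x : X _⦋n⦌), X.δ 0 (s n x) = x)
    (h : ∀ (n : ℕ) (i : Fin (n + 2)) (x : X _⦋n + 1⦌),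
      X.δ i.succ (s (n + 1) x) = s n (X.δ i x)) (n : ℕ) :
    IsZero (X.homology R (n + 1)) := by
  let K := X.chainComplex R
  let S (k : ℕ) : K.X k ⟶ K.X (k + 1) :=
    Cofan.IsColimit.desc (X.isColimitChainComplexXCofan R k) (fun x => X.ιChainComplex (s k x))
  have hS (k : ℕ) (x : X _⦋k⦌) : X.ιChainComplex x ≫ S k = X.ιChainComplex (s k x) :=
    Cofan.IsColimit.fac (X.isColimitChainComplexXCofan R k) _ x
  have key : 𝟙 (K.X (n + 1)) = K.d (n + 1) n ≫ S n + S (n + 1) ≫ K.d (n + 2) (n + 1) := by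
    apply chainComplex_hom_ext
    intro x
    rw [Preadditive.comp_add, ιChainComplex_d_assoc, reassoc_of% (hS (n + 1) x),
      ιChainComplex_d]
    rw [Fin.sum_univ_succ (n := n + 2)]
    simp only [h₀, h, Preadditive.sum_comp, Preadditive.zsmul_comp, hS, Fin.val_succ, pow_succ]
    simp [K]
  have hc : 𝟙 (K.cycles (n + 1)) =
      K.iCycles (n + 1) ≫ S (n + 1) ≫ K.toCycles (n + 2) (n + 1) := by
    rw [← cancel_mono (K.iCycles (n + 1))]
    have := K.iCycles (n + 1) ≫= key
    simpa using this
  refine IsZero.of_epi_eq_zero (K.homologyπ (n + 1)) ?_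
  rw [← Category.id_comp (K.homologyπ (n + 1)), hc]
  simp

variable {X Y : SSet.{0}} (T : X ⟶ X) (p : X ⟶ Y) (e : ∀ n : ℕ, Y _⦋n⦌ → ℕ → X _⦋n⦌)

/-- The sequence `C(X) ⟶ C(X) ⟶ C(Y)` of chain complexes with first map `1 - T`. -/
noncomputable abbrev shiftComplex (R : C) (hT : T ≫ p = p) :
    ShortComplex (ChainComplex C ℕ) :=
  ShortComplex.mk (𝟙 (X.chainComplex R) - chainComplexMap T R) (chainComplexMap p R) (by
    rw [Preadditive.sub_comp, Category.id_comp, ← Functor.map_comp, hT, sub_self])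

/-- Let the `n`-simplices of `X` over each simplex `y` of `Y` be enumerated, without repetitions, as
`e n y 0, e n y 1, …`, so that `T` maps each one to the next. Then the sequence `1 - T`, `p` is
split in degree `n`. With `yₘ = e n y m`, the retraction of `1 - T` sends `yₘ` to
`(yₘ - y₀) / (1 - T) = -(y₀ + ⋯ + yₘ₋₁)`. -/
noncomputable def shiftComplexSplitting (R : C) (hT : T ≫ p = p) (n : ℕ)
    (heT : ∀ y m, T.app _ (e n y m) = e n y (m + 1)) (hep : ∀ y m, p.app _ (e n y m) = y)
    (he : ∀ y, Function.Injective (e n y)) (he' : ∀ x : X _⦋n⦌, ∃ y m, e n y m = x) :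
    ((shiftComplex T p R hT).map (HomologicalComplex.eval C _ n)).Splitting := by
  let r₀ (x : X _⦋n⦌) : R ⟶ (X.chainComplex R).X n :=
    -∑ j ∈ Finset.range (he' x).choose_spec.choose, X.ιChainComplex (e n (he' x).choose j)
  have hr₀ (y m) : r₀ (e n y m) = -∑ j ∈ Finset.range m, X.ιChainComplex (e n y j) := by
    have h := (he' (e n y m)).choose_spec.choose_spec
    have hy : (he' (e n y m)).choose = y := by
      have := congrArg (p.app _) h
      rwa [hep, hep] at this
    have hm : (he' (e n y m)).choose_spec.choose = m := he y (by convert! h; rw [hy])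
    simp only [r₀]
    rw [hm, hy]
  let r : (X.chainComplex R).X n ⟶ (X.chainComplex R).X n :=
    Cofan.IsColimit.desc (X.isColimitChainComplexXCofan R n) r₀
  have hr (y m) : X.ιChainComplex (e n y m) ≫ r =
      -∑ j ∈ Finset.range m, X.ιChainComplex (e n y j) :=
    (Cofan.IsColimit.fac (X.isColimitChainComplexXCofan R n) r₀ (e n y m)).trans (hr₀ y m)
  let s : (Y.chainComplex R).X n ⟶ (X.chainComplex R).X n :=
    Cofan.IsColimit.desc (Y.isColimitChainComplexXCofan R n) (fun y => X.ιChainComplex (e n y 0))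
  have hs (y) : Y.ιChainComplex y ≫ s = X.ιChainComplex (e n y 0) :=
    Cofan.IsColimit.fac (Y.isColimitChainComplexXCofan R n) _ y
  have hf (y m) : X.ιChainComplex (R := R) (e n y m) ≫
      (𝟙 (X.chainComplex R) - chainComplexMap T R).f n =
      X.ιChainComplex (e n y m) - X.ιChainComplex (e n y (m + 1)) := by
    rw [HomologicalComplex.sub_f_apply, Preadditive.comp_sub, ι_chainComplexMap_f, heT]
    simp
  refine { r := r, s := s, f_r := ?_, s_g := ?_, id := ?_ }
  · change (𝟙 (X.chainComplex R) - chainComplexMap T R).f n ≫ r = 𝟙 _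
    apply chainComplex_hom_ext
    intro x
    obtain ⟨y, m, rfl⟩ := he' x
    rw [← Category.assoc, hf, Preadditive.sub_comp, hr, hr, Finset.sum_range_succ]
    simp
  · change s ≫ (chainComplexMap p R).f n = 𝟙 _
    apply chainComplex_hom_ext
    intro y
    rw [← Category.assoc, hs, ι_chainComplexMap_f, hep]
    simp
  · change r ≫ (𝟙 (X.chainComplex R) - chainComplexMap T R).f n +
      (chainComplexMap p R).f n ≫ s = 𝟙 _
    apply chainComplex_hom_ext
    intro x
    obtain ⟨y, m, rfl⟩ := he' x
    rw [Preadditive.comp_add, ← Category.assoc, hr, Preadditive.neg_comp, Preadditive.sum_comp,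
      ι_chainComplexMap_f_assoc, hep, hs, Finset.sum_congr rfl (fun j _ => hf y j),
      Finset.sum_range_sub']
    simp

end ChainComplex

/-- Let `X` be a connected simplicial set without homology in positive degrees, `T` an endomorphism
of `X` whose iterates act freely on simplices, and `Y` the connected quotient. Then `Y` has the
homology of a circle. Freeness and the quotient are expressed by the bijections `e n` from pairs of
an `n`-simplex of `Y` and a natural number to the `n`-simplices of `X`. -/
theorem homology_of_shift {X Y : SSet.{0}} [X.IsConnected] [Y.IsConnected]
    (T : X ⟶ X) (p : X ⟶ Y) (hT : T ≫ p = p) (e : ∀ n : ℕ, Y _⦋n⦌ → ℕ → X _⦋n⦌)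
    (heT : ∀ n y m, T.app _ (e n y m) = e n y (m + 1)) (hep : ∀ n y m, p.app _ (e n y m) = y)
    (he : ∀ n y, Function.Injective (e n y)) (he' : ∀ n (x : X _⦋n⦌), ∃ y m, e n y m = x)
    (hX : ∀ n, IsZero (X.homology (AddCommGrpCat.of ℤ) (n + 1))) :
    Nonempty ((Y.homology (AddCommGrpCat.of ℤ) 0 : AddCommGrpCat.{0}) ≃+ ℤ) ∧
    Nonempty ((Y.homology (AddCommGrpCat.of ℤ) 1 : AddCommGrpCat.{0}) ≃+ ℤ) ∧
    ∀ k : ℕ, 1 < k → Subsingleton (Y.homology (AddCommGrpCat.of ℤ) k : AddCommGrpCat.{0}) := by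
  let S := shiftComplex T p (AddCommGrpCat.of ℤ) hT
  have hS : S.ShortExact := HomologicalComplex.shortExact_of_degreewise_shortExact S fun n =>
    (shiftComplexSplitting T p e _ hT n (heT n) (hep n) (he n) (he' n)).shortExact
  let aX : X.homology (AddCommGrpCat.of ℤ) 0 ≅ AddCommGrpCat.of ℤ := asIso (X.homology₀ε _)
  let aY : Y.homology (AddCommGrpCat.of ℤ) 0 ≅ AddCommGrpCat.of ℤ := asIso (Y.homology₀ε _)
  refine ⟨⟨aY.addCommGroupIsoToAddEquiv⟩, ?_, ?_⟩
  · -- `H₀(p)` is a surjective endomorphism of `ℤ`, hence injective, so that `H₀(1 - T) = 0`.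
    let q : X.homology (AddCommGrpCat.of ℤ) 0 ⟶ Y.homology (AddCommGrpCat.of ℤ) 0 :=
      HomologicalComplex.homologyMap S.g 0
    have hepi : Epi q := by
      have := hS.epi_g
      exact HomologicalComplex.epi_homologyMap_of_epi_of_not_rel S.g 0 (by simp)
    have hmono : Mono q := by
      let φ : AddCommGrpCat.of ℤ ⟶ AddCommGrpCat.of ℤ := aX.inv ≫ q ≫ aY.hom
      have hφ : Function.Surjective φ := (AddCommGrpCat.epi_iff_surjective φ).1 inferInstance
      have hφ' : Function.Injective φ :=
        IsNoetherian.injective_of_surjective_endomorphism φ.hom.toIntLinearMap hφ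
      have : Mono φ := (AddCommGrpCat.mono_iff_injective φ).2 hφ'
      have h : q = aX.hom ≫ φ ≫ aY.inv := by simp [φ]
      rw [h]
      infer_instance
    have hzero : HomologicalComplex.homologyMap S.f 0 = 0 := by
      rw [← cancel_mono q, zero_comp, ← HomologicalComplex.homologyMap_comp, S.zero,
        HomologicalComplex.homologyMap_zero]
    have hrel : (ComplexShape.down ℕ).Rel 1 0 := by simp
    have := hS.mono_δ 1 0 hrel (hX 0)
    have : Epi (hS.δ 1 0 hrel) := (hS.homology_exact₁ 1 0 hrel).epi_f hzero
    have : IsIso (hS.δ 1 0 hrel) := isIso_of_mono_of_epi _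
    exact ⟨(asIso (hS.δ 1 0 hrel) ≪≫ aX).addCommGroupIsoToAddEquiv⟩
  · intro k hk
    obtain ⟨k, rfl⟩ := Nat.exists_eq_add_of_le' hk
    have hrel : (ComplexShape.down ℕ).Rel (k + 2) (k + 1) := by simp
    have := hS.isIso_δ (k + 2) (k + 1) hrel (hX (k + 1)) (hX k)
    exact AddCommGrpCat.subsingleton_of_isZero ((hX k).of_iso (asIso (hS.δ (k + 2) (k + 1) hrel)))

end SSet

/-! ### Nerves of categories whose morphisms out of one object are freely generated -/

namespace CategoryTheory

namespace nerve

open Limits Simplicial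

/-- The nerve of a category with an object that maps to all others is connected. -/
theorem isConnected_of_nonempty_hom {C : Type} [Category.{0} C] (o : C)
    (h : ∀ t, Nonempty (o ⟶ t)) : (nerve C).IsConnected where
  nonempty := ⟨ComposableArrows.mk₀ o⟩
  allEq := by
    have key (x : SSet.π₀ (nerve C)) : x = SSet.π₀.mk (nerveEquiv.symm o) := by
      induction x with
      | mk x =>
        obtain ⟨t, rfl⟩ := nerveEquiv.symm.surjective x
        exact (SSet.π₀.sound (nerve.edgeMk (h t).some)).symm
    intro x y
    rw [key x, key y]

/-- The nerve of a category with an initial object has no homology in positive degrees, the cone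
operator being given by putting the initial object in front of a chain of arrows. -/
theorem isZero_homology_of_isInitial {D : Type} [Category.{0} D] {o : D} (ho : IsInitial o)
    (n : ℕ) : IsZero ((nerve D).homology (AddCommGrpCat.of ℤ) (n + 1)) := by
  let s (n : ℕ) (x : (nerve D) _⦋n⦌) : (nerve D) _⦋n + 1⦌ :=
    ComposableArrows.precomp x (ho.to (ComposableArrows.left x))
  have hs (n : ℕ) (x : (nerve D) _⦋n⦌) : (nerve D).δ 0 (s n x) = x := rfl
  refine SSet.isZero_homology_of_cone _ _ s hs (fun n i x => ?_) n
  have hδ : (nerve D).δ 0 ((nerve D).δ i.succ (s (n + 1) x)) =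
      (nerve D).δ 0 (s n ((nerve D).δ i x)) := by
    have := ConcreteCategory.congr_hom
      (SimplicialObject.δ_comp_δ (X := nerve D) (Fin.zero_le i)) (s (n + 1) x)
    exact this
  -- The two chains agree after their first object, which is initial in both of them.
  refine ComposableArrows.ext_succ rfl hδ ?_
  exact IsInitial.hom_ext ho _ _

variable {C : Type} [Category.{0} C] {o : C}

/-- The lift of a chain of arrows to the under category of `o` along a morphism from `o` to the
source of the chain. -/
def liftUnder {n : ℕ} (x : ComposableArrows C n) (f : o ⟶ x.obj 0) :
    ComposableArrows (Under o) n where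
  obj j := Under.mk (f ≫ x.map (homOfLE (Fin.zero_le j)))
  map {i j} a := Under.homMk (x.map a) (by
    dsimp
    rw [Category.assoc, ← x.map_comp]
    rfl)

theorem liftUnder_injective {n : ℕ} (x : ComposableArrows C n) :
    Function.Injective (liftUnder (o := o) x) := by
  intro f f' h
  have h' := Functor.congr_obj h 0
  have h'' : f ≫ x.map (homOfLE (Fin.zero_le 0)) = f' ≫ x.map (homOfLE (Fin.zero_le 0)) := by
    simp only [liftUnder, Under.mk] at h'
    have h3 := (Comma.mk.inj h').2.2
    exact eq_of_heq h3
  have hid : x.map (homOfLE (Fin.zero_le 0)) = 𝟙 _ := x.map_id 0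
  simpa [hid] using h''

theorem under_eqToHom_conj_right {a b c d : Under o} (h : a = b) (h' : c = d) (f : b ⟶ c) :
    (eqToHom h ≫ f ≫ eqToHom h').right =
      eqToHom (congrArg Comma.right h) ≫ f.right ≫ eqToHom (congrArg Comma.right h') := by
  subst h h'
  simp

/-- Every chain of arrows in the under category is a lift of its underlying chain. -/
theorem liftUnder_forget {n : ℕ} (y : ComposableArrows (Under o) n) :
    liftUnder (y ⋙ Under.forget o) (y.obj 0).hom = y := by
  refine Functor.ext (fun j => ?_) (fun i j a => ?_)
  · simp only [liftUnder]
    have := Under.w (y.map (homOfLE (Fin.zero_le j)))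
    dsimp
    rw [this]
    rfl
  · ext
    refine Eq.trans ?_ (under_eqToHom_conj_right _ _ _).symm
    exact ((Category.id_comp _).trans (Category.comp_id _)).symm

theorem liftUnder_comp_map {n : ℕ} (x : ComposableArrows C n) (g : o ⟶ o) (f : o ⟶ x.obj 0) :
    liftUnder x f ⋙ Under.map g = liftUnder x (g ≫ f) := by
  have hobj (j) : (liftUnder x f ⋙ Under.map g).obj j = (liftUnder x (g ≫ f)).obj j := by
    dsimp only [liftUnder, Functor.comp_obj]
    rw [Category.assoc]
    rfl
  refine Functor.ext hobj (fun i j a => ?_)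
  ext
  refine Eq.trans ?_ (under_eqToHom_conj_right _ _ _).symm
  exact ((Category.id_comp _).trans (Category.comp_id _)).symm

/-- If the morphisms from `o` to each object `t` form a sequence `γ t 0, γ t 1, …`, without
repetitions, on which precomposition with an endomorphism `g` of `o` acts as the shift, then the
category has the homology of a circle. -/
theorem homology_of_free_hom (g : o ⟶ o) (γ : ∀ t, ℕ → (o ⟶ t))
    (hγ : ∀ t m, γ t (m + 1) = g ≫ γ t m) (h : ∀ t, Function.Bijective (γ t)) :
    Nonempty (((nerve C).homology (AddCommGrpCat.of ℤ) 0 : AddCommGrpCat.{0}) ≃+ ℤ) ∧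
    Nonempty (((nerve C).homology (AddCommGrpCat.of ℤ) 1 : AddCommGrpCat.{0}) ≃+ ℤ) ∧
    ∀ k : ℕ, 1 < k →
      Subsingleton ((nerve C).homology (AddCommGrpCat.of ℤ) k : AddCommGrpCat.{0}) := by
  have hi : IsInitial (Under.mk (𝟙 o)) := Under.mkIdInitial
  have := isConnected_of_nonempty_hom o (fun t => ⟨γ t 0⟩)
  have := isConnected_of_nonempty_hom (Under.mk (𝟙 o)) (fun t => ⟨hi.to t⟩)
  refine SSet.homology_of_shift (X := nerve (Under o)) (Y := nerve C)
    (nerveMap (Under.map g)) (nerveMap (Under.forget o)) rfl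
    (fun n x m => liftUnder x (γ _ m)) (fun n x m => ?_) (fun n x m => rfl)
    (fun n x m m' hm => (h _).1 (liftUnder_injective x hm)) (fun n y => ?_)
    (isZero_homology_of_isInitial hi)
  · simp only [hγ]
    exact liftUnder_comp_map x g _
  · obtain ⟨m, hm⟩ := (h _).2 (ComposableArrows.left (n := n) y).hom
    exact ⟨y ⋙ Under.forget o, m,
      (congrArg (liftUnder (y ⋙ Under.forget o)) hm).trans (liftUnder_forget y)⟩

end nerve

end CategoryTheory

/-! ### Runs of elementary nets -/

namespace ElementaryNet

variable (N : ElementaryNet)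

/-- The trace consisting of the single event `a`. -/
abbrev ev (a : N.E) : TraceMonoid N.E N.Indep := PresentedMonoid.of _ a

/-- The trace `μ` can be executed in the state `s` and leads to the state `t`. -/
def Runs (s : Set N.P) (μ : TraceMonoid N.E N.Indep) (t : Set N.P) : Prop :=
  (N.action μ).app s = some t

open Classical in
/-- The number of occurrences of each event in a trace, as a monoid homomorphism. -/
noncomputable def countHom (a : N.E) : TraceMonoid N.E N.Indep →* Multiplicative ℕ :=
  PresentedMonoid.lift (fun b => Multiplicative.ofAdd (if b = a then 1 else 0)) (by
    rintro _ _ ⟨b, c, -, rfl, rfl⟩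
    rw [map_mul, map_mul, mul_comm])

/-- The number of occurrences of the event `a` in a trace. -/
noncomputable def count (a : N.E) (μ : TraceMonoid N.E N.Indep) : ℕ := (N.countHom a μ).toAdd

variable {N}

@[simp]
theorem count_one (a : N.E) : N.count a 1 = 0 := by simp [count]

@[simp]
theorem count_mul (a : N.E) (μ ν : TraceMonoid N.E N.Indep) :
    N.count a (μ * ν) = N.count a μ + N.count a ν := by simp [count]

open Classical in
theorem count_ev (a b : N.E) : N.count a (N.ev b) = if b = a then 1 else 0 := by
  simp [count, countHom, PresentedMonoid.lift_of]

theorem trace_induction {p : TraceMonoid N.E N.Indep → Prop} (μ : TraceMonoid N.E N.Indep)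
    (one : p 1) (ev_mul : ∀ a μ, p μ → p (N.ev a * μ)) : p μ :=
  Submonoid.induction_of_closure_eq_top_left (PresentedMonoid.closure_range_of _) μ one
    (by rintro _ ⟨a, rfl⟩ μ hμ; exact ev_mul a μ hμ)

theorem ev_mul_comm {a b : N.E} (h : N.Indep a b) : N.ev a * N.ev b = N.ev b * N.ev a := by
  have := PresentedMonoid.mk_eq_mk_of_rel (rels := fun x y : FreeMonoid N.E => ∃ a b : N.E,
    N.Indep a b ∧ x = FreeMonoid.of a * FreeMonoid.of b ∧ y = FreeMonoid.of b * FreeMonoid.of a)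
    ⟨a, b, h, rfl, rfl⟩
  rw [map_mul, map_mul] at this
  exact this

theorem runs_one_iff {s t : Set N.P} : N.Runs s 1 t ↔ s = t := by
  rw [Runs, map_one, PartialSelfMap.one_app, Option.some_inj]

theorem runs_mul_iff {s t : Set N.P} {μ ν : TraceMonoid N.E N.Indep} :
    N.Runs s (μ * ν) t ↔ ∃ u, N.Runs s μ u ∧ N.Runs u ν t := by
  rw [Runs, map_mul, PartialSelfMap.mul_app, Option.bind_eq_some_iff]
  rfl

theorem runs_ev_iff {s t : Set N.P} {a : N.E} :
    N.Runs s (N.ev a) t ↔ N.Enabled s a ∧ (s \ N.pre a) ∪ N.post a = t :=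
  N.step_eq_some_iff a s t

theorem Runs.mul {s t u : Set N.P} {μ ν : TraceMonoid N.E N.Indep} (h : N.Runs s μ t)
    (h' : N.Runs t ν u) : N.Runs s (μ * ν) u :=
  runs_mul_iff.2 ⟨t, h, h'⟩

/-- An event stays enabled when an independent one occurs. -/
theorem Enabled.of_indep {a b : N.E} {s : Set N.P} (ha : N.Enabled s a) (h : N.Indep a b) :
    N.Enabled ((s \ N.pre b) ∪ N.post b) a := by
  simp only [Indep, Enabled, Set.ext_iff, Set.subset_def, Set.mem_inter_iff, Set.mem_union,
    Set.mem_sdiff, Set.mem_empty_iff_false, iff_false] at *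
  grind

variable (N) in
/-- A net is conflict free if distinct events that are enabled in the same state are independent. -/
def ConflictFree : Prop :=
  ∀ (s : Set N.P) (a b : N.E), a ≠ b → N.Enabled s a → N.Enabled s b → N.Indep a b

/-- In a conflict-free net, an event that is enabled at the start of a trace containing it can be
moved to the front: it is independent of everything that precedes its first occurrence. -/
theorem ConflictFree.exists_eq_ev_mul (hN : N.ConflictFree) {a : N.E}
    (μ : TraceMonoid N.E N.Indep) {s t : Set N.P} (ha : N.Enabled s a) (h : N.Runs s μ t)
    (hc : N.count a μ ≠ 0) : ∃ ν, μ = N.ev a * ν := by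
  induction μ using trace_induction generalizing s with
  | one => simp at hc
  | ev_mul b μ ih =>
    obtain ⟨u, hu, hut⟩ := runs_mul_iff.1 h
    obtain ⟨hb, rfl⟩ := runs_ev_iff.1 hu
    by_cases hab : b = a
    · exact ⟨μ, by rw [hab]⟩
    · have hI := hN s a b (Ne.symm hab) ha hb
      obtain ⟨ν, rfl⟩ := ih (ha.of_indep hI) hut (by simpa [count_ev, hab] using hc)
      exact ⟨N.ev b * ν, by rw [← mul_assoc, ← mul_assoc, ev_mul_comm hI]⟩

/-- In a conflict-free net, a trace is determined by a state in which it can be executed and by the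
number of occurrences of each event. -/
theorem ConflictFree.eq_of_count_eq (hN : N.ConflictFree) {μ ν : TraceMonoid N.E N.Indep}
    {s t t' : Set N.P} (hμ : N.Runs s μ t) (hν : N.Runs s ν t')
    (h : ∀ a, N.count a μ = N.count a ν) : μ = ν := by
  induction μ using trace_induction generalizing s ν with
  | one =>
    induction ν using trace_induction with
    | one => rfl
    | ev_mul a ν _ =>
      have := h a
      rw [count_one, count_mul, count_ev, if_pos rfl] at this
      omega
  | ev_mul a μ ih =>
    obtain ⟨u, hu, hut⟩ := runs_mul_iff.1 hμ
    obtain ⟨ha, rfl⟩ := runs_ev_iff.1 hu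
    obtain ⟨ν, rfl⟩ := hN.exists_eq_ev_mul ν ha hν (by rw [← h a]; simp [count_ev])
    obtain ⟨u', hu', hut'⟩ := runs_mul_iff.1 hν
    obtain ⟨-, rfl⟩ := runs_ev_iff.1 hu'
    rw [ih hut hut' fun b => by simpa using h b]

end ElementaryNet

/-! ### Runs of pipelines -/

namespace Pipeline

open ElementaryNet

variable {n : ℕ} {s₀ : Set (Fin (n - 1))}

theorem enabled_iff {s : Set (Fin (n - 1))} {i : Fin n} :
    (pipeline n s₀).Enabled s i ↔ (∀ p : Fin (n - 1), (p : ℕ) + 1 = i → p ∈ s) ∧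
      ∀ p : Fin (n - 1), (p : ℕ) = i → p ∉ s := by
  simp only [Enabled, Set.subset_def, Set.ext_iff, Set.mem_inter_iff, Set.mem_sdiff,
    Set.mem_ofPred_eq, Set.mem_empty_iff_false, iff_false]
  grind

theorem runs_ev_of {s t : Set (Fin (n - 1))} (i : Fin n)
    (hpre : ∀ p : Fin (n - 1), (p : ℕ) + 1 = i → p ∈ s)
    (hpost : ∀ p : Fin (n - 1), (p : ℕ) = i → p ∉ s)
    (ht : ∀ p : Fin (n - 1), p ∈ t ↔ (p ∈ s ∧ (p : ℕ) + 1 ≠ i) ∨ (p : ℕ) = i) :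
    (pipeline n s₀).Runs s ((pipeline n s₀).ev i) t :=
  runs_ev_iff.2 ⟨enabled_iff.2 ⟨hpre, hpost⟩, Set.ext fun p => (ht p).symm⟩

/-- Of two neighbouring events of a pipeline, one consumes from the place into which the other one
produces, so that they are not enabled simultaneously. -/
theorem conflictFree : (pipeline n s₀).ConflictFree := by
  intro s a b hab ha hb
  rw [enabled_iff] at ha hb
  have hab' : (a : ℕ) ≠ b := fun h => hab (Fin.ext h)
  simp only [Indep, Set.ext_iff, Set.mem_inter_iff, Set.mem_union, Set.mem_ofPred_eq,
    Set.mem_empty_iff_false, iff_false]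
  grind

open Classical in
/-- Conservation of tokens in the place between two neighbouring events. -/
theorem count_conservation {μ : TraceMonoid (pipeline n s₀).E (pipeline n s₀).Indep}
    {s t : Set (Fin (n - 1))} (h : (pipeline n s₀).Runs s μ t) (p : Fin (n - 1)) (a b : Fin n)
    (ha : (a : ℕ) = p) (hb : (b : ℕ) = p + 1) :
    (if p ∈ t then 1 else 0) + (pipeline n s₀).count b μ =
      (if p ∈ s then 1 else 0) + (pipeline n s₀).count a μ := by
  induction μ using trace_induction generalizing s with
  | one =>
    rw [runs_one_iff] at h
    simp [h]
  | ev_mul c μ ih =>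
    obtain ⟨u, hu, hut⟩ := runs_mul_iff.1 h
    obtain ⟨hc, rfl⟩ := runs_ev_iff.1 hu
    have := ih hut
    obtain ⟨h1, h2⟩ := enabled_iff.1 hc
    have h1 := h1 p
    have h2 := h2 p
    simp only [Set.mem_union, Set.mem_sdiff, Set.mem_ofPred_eq] at this
    have hca : c = a ↔ (p : ℕ) = c := by rw [Fin.ext_iff, ha, eq_comm]
    have hcb : c = b ↔ (p : ℕ) + 1 = c := by rw [Fin.ext_iff, hb, eq_comm]
    rw [count_mul, count_mul, count_ev, count_ev]
    clear ih hut hu hc h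
    generalize (pipeline n s₀).count b μ = x at *
    generalize (pipeline n s₀).count a μ = y at *
    grind

/-- A run of a pipeline is determined by its end points and the number of occurrences of the last
event: the other numbers follow by conservation of tokens. -/
theorem eq_of_count_last_eq {μ ν : TraceMonoid (pipeline n s₀).E (pipeline n s₀).Indep}
    {s t : Set (Fin (n - 1))} (hμ : (pipeline n s₀).Runs s μ t) (hν : (pipeline n s₀).Runs s ν t)
    (l : Fin n) (hl : (l : ℕ) + 1 = n)
    (h : (pipeline n s₀).count l μ = (pipeline n s₀).count l ν) : μ = ν := by
  refine conflictFree.eq_of_count_eq hμ hν ?_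
  -- Downward induction on the event, starting with the last one.
  have key : ∀ k : ℕ, ∀ i : Fin n, (i : ℕ) + k + 1 = n →
      (pipeline n s₀).count i μ = (pipeline n s₀).count i ν := by
    intro k
    induction k with
    | zero =>
      intro i hi
      obtain rfl : i = l := Fin.ext (by omega)
      exact h
    | succ k ih =>
      intro i hi
      have h1 := ih ⟨i + 1, by omega⟩ (by simp; omega)
      have h2 := count_conservation hμ ⟨i, by omega⟩ i ⟨i + 1, by omega⟩ rfl rfl
      have h3 := count_conservation hν ⟨i, by omega⟩ i ⟨i + 1, by omega⟩ rfl rfl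
      omega
  exact fun i => key (n - 1 - (i : Fin n)) i (by have := (i : Fin n).isLt; omega)

/-- A token can travel from the entry of a pipeline to a place `j`, if the places up to `j` are
empty. -/
theorem exists_runs_insert (j : ℕ) (hj : j < n - 1) (l : Fin n) (hl : (l : ℕ) + 1 = n)
    (s : Set (Fin (n - 1))) (hs : ∀ p ∈ s, j < (p : Fin (n - 1))) :
    ∃ μ, (pipeline n s₀).Runs s μ (insert ⟨j, hj⟩ s) ∧ (pipeline n s₀).count l μ = 0 := by
  induction j with
  | zero =>
    refine ⟨_, runs_ev_of (⟨0, by omega⟩ : Fin n) ?_ ?_ ?_, ?_⟩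
    · simp
    · intro p hp hps
      have := hs p hps
      simp at hp
      omega
    · intro p
      simp [Fin.ext_iff]
      tauto
    · rw [count_ev, if_neg]
      simp [Fin.ext_iff]
      omega
  | succ j ih =>
    obtain ⟨μ, hμ, hc⟩ := ih (by omega) (fun p hp => by have := hs p hp; omega)
    refine ⟨_, hμ.mul (runs_ev_of (⟨j + 1, by omega⟩ : Fin n) ?_ ?_ ?_), ?_⟩
    · intro p hp
      left
      ext
      simpa using hp
    · rintro p hp (hps | hps)
      · simp [Fin.ext_iff] at hp hps
        omega
      · have := hs p hps
        simp at hp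
        omega
    · intro p
      have := hs p
      simp only [Set.mem_insert_iff, Fin.ext_iff]
      grind
    · rw [count_mul, hc, count_ev, if_neg]
      simp [Fin.ext_iff]
      omega

/-- Every state of a pipeline can be produced from the empty one without firing the last event:
fill the places from right to left. -/
theorem exists_runs_from_empty (l : Fin n) (hl : (l : ℕ) + 1 = n) (t : Set (Fin (n - 1))) :
    ∃ μ, (pipeline n s₀).Runs ∅ μ t ∧ (pipeline n s₀).count l μ = 0 := by
  -- Add the places of `t` one by one, the `m` rightmost places being treated after `m` steps.
  have key : ∀ m : ℕ, ∃ μ, (pipeline n s₀).Runs ∅ μ {p ∈ t | n - 1 ≤ (p : Fin (n - 1)) + m} ∧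
      (pipeline n s₀).count l μ = 0 := by
    intro m
    induction m with
    | zero =>
      refine ⟨1, runs_one_iff.2 ?_, count_one _⟩
      ext p
      have := p.isLt
      simp
      omega
    | succ m ih =>
      obtain ⟨μ, hμ, hc⟩ := ih
      by_cases h : ∃ q ∈ t, (q : Fin (n - 1)) + m + 1 = n - 1
      · obtain ⟨q, hqt, hq⟩ := h
        obtain ⟨ν, hν, hc'⟩ := exists_runs_insert (s₀ := s₀) q q.isLt l hl
          {p ∈ t | n - 1 ≤ (p : Fin (n - 1)) + m} (by
            intro p hp
            have := hp.2
            omega)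
        refine ⟨μ * ν, ?_, by rw [count_mul, hc, hc']⟩
        convert hμ.mul hν using 1
        ext p
        simp only [Set.mem_ofPred_eq, Set.mem_insert_iff, Fin.ext_iff, Fin.eta]
        constructor
        · rintro ⟨h1, h2⟩
          by_cases h3 : (p : ℕ) = q
          · exact Or.inl h3
          · exact Or.inr ⟨h1, by omega⟩
        · rintro (h1 | ⟨h1, h2⟩)
          · obtain rfl := Fin.ext h1
            exact ⟨hqt, by omega⟩
          · exact ⟨h1, by omega⟩
      · refine ⟨μ, ?_, hc⟩
        convert hμ using 1
        ext p
        refine and_congr_right fun hp => ?_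
        have h1 : ¬ (p : ℕ) + m + 1 = n - 1 := fun h' => h ⟨p, hp, h'⟩
        omega
  obtain ⟨μ, hμ, hc⟩ := key n
  refine ⟨μ, ?_, hc⟩
  convert hμ using 1
  ext p
  simp only [Set.mem_ofPred_eq]
  exact ⟨fun h => ⟨h, by omega⟩, fun h => h.1⟩

/-- A token travels through the whole empty pipeline. -/
theorem exists_runs_loop (hn : 2 ≤ n) (l : Fin n) (hl : (l : ℕ) + 1 = n) :
    ∃ μ, (pipeline n s₀).Runs ∅ μ ∅ ∧ (pipeline n s₀).count l μ = 1 := by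
  obtain ⟨μ, hμ, hc⟩ := exists_runs_from_empty (s₀ := s₀) l hl {⟨n - 2, by omega⟩}
  refine ⟨_, hμ.mul (runs_ev_of l ?_ ?_ ?_), ?_⟩
  · intro p hp
    ext
    simp
    omega
  · intro p hp
    have := p.isLt
    omega
  · intro p
    have := p.isLt
    simp [Fin.ext_iff]
    omega
  · rw [count_mul, hc, count_ev, if_pos rfl]

/-- The rightmost token of a state can leave the pipeline. -/
theorem exists_runs_erase (k : ℕ) (j : Fin (n - 1)) (hk : j + k + 1 = n - 1)
    (s : Set (Fin (n - 1))) (hj : j ∈ s) (hs : ∀ p ∈ s, p ≤ j) :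
    ∃ μ, (pipeline n s₀).Runs s μ (s \ {j}) := by
  induction k generalizing j s with
  | zero =>
    refine ⟨_, runs_ev_of (⟨j + 1, by omega⟩ : Fin n) ?_ ?_ ?_⟩
    · intro p hp
      obtain rfl : p = j := Fin.ext (by simpa using hp)
      exact hj
    · intro p hp
      have := p.isLt
      simp at hp
      omega
    · intro p
      have := p.isLt
      simp [Fin.ext_iff]
      omega
  | succ k ih =>
    have hj1 : (j : ℕ) + 1 < n - 1 := by omega
    obtain ⟨ν, hν⟩ := ih ⟨j + 1, hj1⟩ (by simp; omega) (insert ⟨j + 1, hj1⟩ (s \ {j}))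
      (Set.mem_insert _ _) (by
        rintro p (rfl | hp)
        · exact le_rfl
        · have h1 : (p : ℕ) ≤ j := hs p hp.1
          exact Fin.le_def.2 (Nat.le_succ_of_le h1))
    refine ⟨_, Runs.mul (runs_ev_of (⟨j + 1, by omega⟩ : Fin n) ?_ ?_ ?_)
      (?_ : (pipeline n s₀).Runs (insert ⟨j + 1, hj1⟩ (s \ {j})) ν (s \ {j}))⟩
    · intro p hp
      obtain rfl : p = j := Fin.ext (by simpa using hp)
      exact hj
    · intro p hp hps
      have h1 : (p : ℕ) ≤ j := hs p hps
      have h2 : (p : ℕ) = j + 1 := hp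
      omega
    · intro p
      simp [Fin.ext_iff]
      tauto
    · convert hν using 1
      ext p
      have h1 : p ∈ s → (p : ℕ) ≤ j := hs p
      simp only [Set.mem_sdiff, Set.mem_insert_iff, Set.mem_singleton_iff, Fin.ext_iff]
      grind

/-- Every state of a pipeline can be emptied, from right to left. -/
theorem exists_runs_to_empty (s : Set (Fin (n - 1))) : ∃ μ, (pipeline n s₀).Runs s μ ∅ := by
  have key : ∀ (m : ℕ) (s : Set (Fin (n - 1))), (∀ p ∈ s, (p : Fin (n - 1)) < m) →
      ∃ μ, (pipeline n s₀).Runs s μ ∅ := by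
    intro m
    induction m with
    | zero => exact fun s hs => ⟨1, runs_one_iff.2 (Set.eq_empty_of_forall_notMem
        fun p hp => Nat.not_lt_zero _ (hs p hp))⟩
    | succ m ih =>
      intro s hs
      by_cases h : ∃ q ∈ s, (q : Fin (n - 1)) = m
      · obtain ⟨q, hqs, hq⟩ := h
        obtain ⟨μ, hμ⟩ := exists_runs_erase (s₀ := s₀) (n - 1 - q - 1) q (by omega) s hqs
          (fun p hp => by have := hs p hp; rw [Fin.le_def]; omega)
        obtain ⟨ν, hν⟩ := ih (s \ {q}) (fun p hp => by
          have h1 := hs p hp.1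
          have h2 : (p : ℕ) ≠ q := fun h => hp.2 (Fin.ext h)
          omega)
        exact ⟨μ * ν, hμ.mul hν⟩
      · refine ih s fun p hp => ?_
        have h1 := hs p hp
        have h2 : (p : ℕ) ≠ m := fun h' => h ⟨p, hp, h'⟩
        omega
  exact key n s fun p _ => by omega

end Pipeline

/-! ### Homology of pipelines -/

theorem mainTheorem1 (n : ℕ) (hn : 2 ≤ n) (s₀ : Set (Fin (n - 1))) :
    Nonempty ((pipeline n s₀).homology 0 ≃+ ℤ) ∧
    Nonempty ((pipeline n s₀).homology 1 ≃+ ℤ) ∧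
    ∀ k : ℕ, 1 < k → Subsingleton ((pipeline n s₀).homology k) := by
  let l : Fin n := ⟨n - 1, by omega⟩
  have hl : (l : ℕ) + 1 = n := Nat.sub_add_cancel (by omega)
  -- The trace `κ` shows that the empty state is reachable.
  obtain ⟨κ, hκ⟩ := Pipeline.exists_runs_to_empty (s₀ := s₀) s₀
  obtain ⟨g, hg, hgc⟩ := Pipeline.exists_runs_loop (s₀ := s₀) hn l hl
  choose ε hε hεc using Pipeline.exists_runs_from_empty (s₀ := s₀) l hl
  let o : (pipeline n s₀).ReachableCategory := ⟨⟨∅⟩, κ, hκ⟩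
  have hrun (t : Set (Fin (n - 1))) (m : ℕ) : (pipeline n s₀).Runs ∅ (g ^ m * ε t) t := by
    induction m with
    | zero => simpa using hε t
    | succ m ih => rw [pow_succ', mul_assoc]; exact hg.mul ih
  have hcount (t : Set (Fin (n - 1))) (m : ℕ) : (pipeline n s₀).count l (g ^ m * ε t) = m := by
    induction m with
    | zero => simpa using hεc t
    | succ m ih => rw [pow_succ', mul_assoc, ElementaryNet.count_mul, ih, hgc, add_comm]
  refine CategoryTheory.nerve.homology_of_free_hom (o := o) (ObjectProperty.homMk ⟨g, hg⟩)
    (fun t m => ObjectProperty.homMk ⟨g ^ m * ε t.obj.state, hrun _ m⟩) (fun t m => ?_)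
    (fun t => ⟨fun m m' h => ?_, fun f => ?_⟩)
  · refine ObjectProperty.hom_ext _ (Subtype.ext ?_)
    change g ^ (m + 1) * ε t.obj.state = g * (g ^ m * ε t.obj.state)
    rw [pow_succ', mul_assoc]
  · have h' : g ^ m * ε t.obj.state = g ^ m' * ε t.obj.state :=
      congrArg (fun f : o ⟶ t => f.hom.1) h
    rw [← hcount t.obj.state m, h', hcount]
  · refine ⟨(pipeline n s₀).count l f.hom.1, ObjectProperty.hom_ext _ (Subtype.ext ?_)⟩
    exact Pipeline.eq_of_count_last_eq (hrun _ _) f.hom.2 l hl (hcount _ _)
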